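/- **Setting.** Let $n_a,n_b,T\in\mathbb N$, let $\hat u=(\hat u_t)_{t=-n_b+1}^{T-1}$ and $\hat y=(\hat y_t)_{t=-n_a+1}^{T}$ be real data, and let $\epsilon_u,\epsilon_y\ge 0$. For $(a,b)\in\mathbb R^{n_a}\times\mathbb R^{n_b}$ put $$h_t(a,b)=\hat y_t+\sum_{i=1}^{n_a}a_i\hat y_{t-i}-\sum_{i=1}^{n_b}b_i\hat u_{t-i}\qquad(t=1,\dots,T).$$ Let $\bar{\mathcal P}$ be the set of all $(a,b,\Delta u,\Delta y)\in\mathbb R^{n_a}\times\mathbb R^{n_b}\times\mathbb R^{T+n_b-1}\times\mathbb R^{T+n_a}$, with $\Delta u,\Delta y$ indexed by the same times as $\hat u,\hat y$, such that $\|\Delta u\|_\infty\le\epsilon_u$, $\|\Delta y\|_\infty\le\epsilon_y$ and $$0=h_t(a,b)-\sum_{i=1}^{n_a}a_i\Delta y_{t-i}+\sum_{i=1}^{n_b}b_i\Delta u_{t-i}-\Delta y_t\qquad(t=1,\dots,T),$$ and let $\mathcal P$ be its projection to the coordinates $(a,b)$. For a basic semialgebraic set $\Pi=\{x\in\mathbb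 R^{n_a+n_b}: g_k(x)\ge 0,\ h'_j(x)=0\}$, described by finitely many polynomials $g_k,h'_j$, let $\Sigma[\Pi]$ be the set of polynomials $\sigma_0+\sum_k\sigma_kg_k+\sum_j\phi_jh'_j$ with $\sigma_0,\sigma_k$ sums of squares of polynomials and $\phi_j$ arbitrary polynomials, and let $\Sigma[\Pi]_{\le 2d}$ be the set of those with such a representation in which every term $\sigma_0,\sigma_kg_k,\phi_jh'_j$ has degree at most $2d$. The set $\Pi$ (with its description) is Archimedean if $R-\|x\|_2^2\in\Sigma[\Pi]$ for some $R>0$. For $q\in\mathbb R[a,b]$, a *degree-$d$ Alternatives Psatz* for $q$ consists of polynomials $\psi^\pm_t$ ($-n_b+1\le t\le T-1$) and $\zeta^\pm_t$ ($-n_a+1\le t\le T$) in $\Sigma[\Pi]_{\le 2d}$ and $\mu_t\in\mathbb R[a,b]_{\le 2d-1}$ ($1\le t\le T$) such that, with $\mu_s=0$ for $s\notin\{1,\dots,T\}$, $$\psi^+_t-\psi^-_t=\sum_{i=1}^{n_b}b_i\,\mu_{t+i},\qquad \zeta^+_t-\zeta^-_t=\mu_t+\sum_{i=1}^{n_a}a_i\,\mu_{t+i}$$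 for all $t$ in the respective ranges (that is, $\psi^+-\psi^-=\mu\star b$ and $\zeta^+-\zeta^-=\mu\star[1;a]$), and $-Q\in\Sigma[\Pi]_{\le 2d}$, where $$Q=-q+\epsilon_u\sum_t(\psi^+_t+\psi^-_t)+\sum_{t=1}^{T}h_t\mu_t+\epsilon_y\sum_t(\zeta^+_t+\zeta^-_t).$$ **Proposition.** Assume that (A1) $\bar{\mathcal P}$ is compact and (A2) $\Pi\supseteq\mathcal P$ is Archimedean. Let $q\in\mathbb R[a,b]$. 1. For every $d$ and every degree-$d$ Alternatives Psatz for $q$, $0\le -Q\le q$ on $\mathcal P$. 2. $q>0$ on $\mathcal P$ if and only if there is $d_0$ such that for every $d\ge d_0$ there is a degree-$d$ Alternatives Psatz for $q$ with $-Q>0$ on $\mathcal P$. In particular, if $q>0$ on $\mathcal P$, then the degree-$d$ Alternatives Psatz is feasible for all sufficiently large $d$. -/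

import Mathlib

noncomputable section

namespace EIV

/-! ### Basic semialgebraic sets and weighted sums of squares -/

/-- A description of a basic semialgebraic set in the variables `σ`: finitely many polynomials `g k`
(inequality constraints `g k ≥ 0`) and finitely many polynomials `h k` (equality constraints
`h k = 0`). -/
structure BSA (σ : Type) where
  /-- number of inequality constraints -/
  numIneq : ℕ
  /-- number of equality constraints -/
  numEq : ℕ
  /-- the inequality constraints -/
  g : Fin numIneq → MvPolynomial σ ℝ
  /-- the equality constraints -/
  h : Fin numEq → MvPolynomial σ ℝ

namespace BSA

variable {σ : Type}

/-- The set of real points described by `K`. -/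
def carrier (K : BSA σ) : Set (σ → ℝ) :=
  {x | (∀ k, 0 ≤ MvPolynomial.eval x (K.g k)) ∧ (∀ k, MvPolynomial.eval x (K.h k) = 0)}

/-- The weighted sums of squares `Σ[K]`: polynomials `σ₀ + ∑ σᵢ gᵢ + ∑ φⱼ hⱼ` with `σ₀`, `σᵢ` sums of
squares of polynomials and `φⱼ` arbitrary polynomials. -/
def WSOS (K : BSA σ) : Set (MvPolynomial σ ℝ) :=
  {p | ∃ (s₀ : MvPolynomial σ ℝ) (s : Fin K.numIneq → MvPolynomial σ ℝ)
      (φ : Fin K.numEq → MvPolynomial σ ℝ),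
      IsSumSq s₀ ∧ (∀ k, IsSumSq (s k)) ∧
      p = s₀ + ∑ k, s k * K.g k + ∑ k, φ k * K.h k}

/-- The degree-truncated weighted sums of squares: every term `σ₀`, `σᵢ gᵢ`, `φⱼ hⱼ` of the
certificate has degree at most `n`. The set `Σ[K]_{≤ 2d}` is `K.WSOSLe (2 * d)`. -/
def WSOSLe (K : BSA σ) (n : ℕ) : Set (MvPolynomial σ ℝ) :=
  {p | ∃ (s₀ : MvPolynomial σ ℝ) (s : Fin K.numIneq → MvPolynomial σ ℝ)
      (φ : Fin K.numEq → MvPolynomial σ ℝ),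
      IsSumSq s₀ ∧ (∀ k, IsSumSq (s k)) ∧
      s₀.totalDegree ≤ n ∧ (∀ k, (s k * K.g k).totalDegree ≤ n) ∧
      (∀ k, (φ k * K.h k).totalDegree ≤ n) ∧
      p = s₀ + ∑ k, s k * K.g k + ∑ k, φ k * K.h k}

/-- The Archimedean condition: `R - ‖x‖₂² ∈ Σ[K]` for some `R > 0`. -/
def IsArchimedean [Fintype σ] (K : BSA σ) : Prop :=
  ∃ R : ℝ, 0 < R ∧
    (MvPolynomial.C R - ∑ i, MvPolynomial.X i ^ 2 : MvPolynomial σ ℝ) ∈ K.WSOS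

end BSA

/-! ### Errors-in-variables data of an ARX model -/

/-- The integers from `r` to `s`, both included. -/
abbrev Times (r s : ℤ) : Type := Set.Icc r s

/-- The variables `(a, b)`: `Sum.inl i` is `a_{i+1}` and `Sum.inr i` is `b_{i+1}`. -/
abbrev Var (na nb : ℕ) : Type := Fin na ⊕ Fin nb

/-- The times `-n_b+1, …, T-1` at which the input is recorded. -/
abbrev TimesU (nb T : ℕ) : Type := Times (-nb + 1) (T - 1)

/-- The times `-n_a+1, …, T` at which the output is recorded. -/
abbrev TimesY (na T : ℕ) : Type := Times (-na + 1) T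

/-- The time `t - (i + 1)`, as an input time. -/
def lagU {nb T : ℕ} (t : Times 1 T) (i : Fin nb) : TimesU nb T :=
  ⟨t.1 - (i.1 + 1), by
    have h1 := t.2.1
    have h2 := t.2.2
    have h3 := i.2
    constructor <;> omega⟩

/-- The time `t - (i + 1)`, as an output time. -/
def lagY {na T : ℕ} (t : Times 1 T) (i : Fin na) : TimesY na T :=
  ⟨t.1 - (i.1 + 1), by
    have h1 := t.2.1
    have h2 := t.2.2
    have h3 := i.2
    constructor <;> omega⟩

/-- The time `t`, as an output time. -/
def nowY {na T : ℕ} (t : Times 1 T) : TimesY na T :=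
  ⟨t.1, by
    have h1 := t.2.1
    have h2 := t.2.2
    constructor <;> omega⟩

/-- Recorded input-output data of an ARX model with `na` output and `nb` input coefficients over the
horizon `T`, with the bounds of the input and of the output noise. -/
structure Data (na nb T : ℕ) where
  /-- recorded input -/
  uhat : TimesU nb T → ℝ
  /-- recorded output -/
  yhat : TimesY na T → ℝ
  /-- input noise bound -/
  epsU : ℝ
  /-- output noise bound -/
  epsY : ℝ

namespace Data

variable {na nb T : ℕ}

/-- `h_t = ŷ_t + ∑ a_i ŷ_{t-i} - ∑ b_i û_{t-i}`, a polynomial in `(a, b)`. -/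
def h (D : Data na nb T) (t : Times 1 T) : MvPolynomial (Var na nb) ℝ :=
  MvPolynomial.C (D.yhat (nowY t))
    + ∑ i : Fin na, MvPolynomial.X (Sum.inl i) * MvPolynomial.C (D.yhat (lagY t i))
    - ∑ i : Fin nb, MvPolynomial.X (Sum.inr i) * MvPolynomial.C (D.uhat (lagU t i))

/-- The set of all `((a, b), Δu, Δy)` consistent with the data (norms are sup-norms). -/
def Pbar (D : Data na nb T) :
    Set ((Var na nb → ℝ) × (TimesU nb T → ℝ) × (TimesY na T → ℝ)) :=
  {z | ‖z.2.1‖ ≤ D.epsU ∧ ‖z.2.2‖ ≤ D.epsY ∧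
    ∀ t : Times 1 T,
      0 = MvPolynomial.eval z.1 (D.h t)
        + (-(∑ i : Fin na, z.1 (Sum.inl i) * z.2.2 (lagY t i))
          + ∑ i : Fin nb, z.1 (Sum.inr i) * z.2.1 (lagU t i))
        - z.2.2 (nowY t)}

/-- The set of parameters `(a, b)` consistent with the data: the projection of `Pbar`. -/
def P (D : Data na nb T) : Set (Var na nb → ℝ) := Prod.fst '' D.Pbar

end Data

/-! ### The Alternatives Psatz -/

/-- Extension by zero of a sequence indexed by `1, …, T`. -/
def extendZero {R : Type} [Zero R] {T : ℕ} (x : Times 1 T → R) (t : ℤ) : R :=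
  if ht : t ∈ Set.Icc (1 : ℤ) T then x ⟨t, ht⟩ else 0

/-- The cross-correlation of `{x_t}_{t=1}^T` (zero outside `1, …, T`) with `{y_i}_{i=1}^n`:
`(x ⋆ y)_j = ∑_{i=1}^n x_{i+j-n} y_i`, for `j = 1, …, T+n-1`. The index `i : Fin n` stands
for `i + 1`. -/
def crossCorr {R : Type} [CommRing R] {T n : ℕ} (x : Times 1 T → R) (y : Fin n → R) (j : ℤ) : R :=
  ∑ i : Fin n, extendZero x ((i.1 + 1 : ℤ) + j - n) * y i

/-- Polynomial multipliers `(ψ^±, ζ^±, μ)` in the variables `(a, b)`. -/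
structure Multipliers (na nb T : ℕ) where
  /-- multipliers of `ε_u - Δu_t ≥ 0` -/
  psiP : TimesU nb T → MvPolynomial (Var na nb) ℝ
  /-- multipliers of `ε_u + Δu_t ≥ 0` -/
  psiM : TimesU nb T → MvPolynomial (Var na nb) ℝ
  /-- multipliers of one of the two output noise bounds -/
  zetaP : TimesY na T → MvPolynomial (Var na nb) ℝ
  /-- multipliers of the other one -/
  zetaM : TimesY na T → MvPolynomial (Var na nb) ℝ
  /-- multipliers of the data-consistency equations -/
  mu : Times 1 T → MvPolynomial (Var na nb) ℝ

namespace Multipliers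

variable {na nb T : ℕ}

/-- `Q = -q + ε_u 1ᵀ(ψ⁺ + ψ⁻) + hᵀ μ + ε_y 1ᵀ(ζ⁺ + ζ⁻)`. -/
def Q (m : Multipliers na nb T) (D : Data na nb T) (q : MvPolynomial (Var na nb) ℝ) :
    MvPolynomial (Var na nb) ℝ :=
  -q + MvPolynomial.C D.epsU * ∑ t, (m.psiP t + m.psiM t)
    + ∑ t, D.h t * m.mu t
    + MvPolynomial.C D.epsY * ∑ t, (m.zetaP t + m.zetaM t)

/-- The multipliers `m` form a degree-`d` Alternatives Psatz for `q`, relative to the semialgebraic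
description `K`. The entry of a vector over `-n_b+1, …, T-1` (over `-n_a+1, …, T`) at time `t` has
position `t + n_b` (position `t + n_a`). -/
structure IsAlternPsatz (m : Multipliers na nb T) (D : Data na nb T) (K : BSA (Var na nb)) (d : ℕ)
    (q : MvPolynomial (Var na nb) ℝ) : Prop where
  psiP_mem : ∀ t, m.psiP t ∈ K.WSOSLe (2 * d)
  psiM_mem : ∀ t, m.psiM t ∈ K.WSOSLe (2 * d)
  zetaP_mem : ∀ t, m.zetaP t ∈ K.WSOSLe (2 * d)
  zetaM_mem : ∀ t, m.zetaM t ∈ K.WSOSLe (2 * d)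
  /-- every monomial of `μ_t` has degree at most `2d - 1` -/
  mu_degree : ∀ t, ∀ e ∈ (m.mu t).support, e.degree + 1 ≤ 2 * d
  neg_Q_mem : -(m.Q D q) ∈ K.WSOSLe (2 * d)
  /-- `ψ⁺ - ψ⁻ = μ ⋆ b` -/
  psi_eq : ∀ t : TimesU nb T, m.psiP t - m.psiM t =
    crossCorr m.mu (fun i : Fin nb => MvPolynomial.X (Sum.inr i)) (t.1 + nb)
  /-- `ζ⁺ - ζ⁻ = μ ⋆ [1; a]` -/
  zeta_eq : ∀ t : TimesY na T, m.zetaP t - m.zetaM t =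
    crossCorr m.mu
      (Fin.cons 1 (fun i : Fin na => MvPolynomial.X (Sum.inl i)) :
        Fin (na + 1) → MvPolynomial (Var na nb) ℝ) (t.1 + na)

end Multipliers

end EIV

end

/-! ### Archimedean quadratic modules and Putinar's Positivstellensatz -/

/-! At a fixed $x=(a,b)$ the noise enters linearly: $x\in\mathcal P$ iff $h(x)$ lies in the image of
the noise box under a linear map. If it does not, a separating hyperplane gives $\mu$ with
$\epsilon_u\|\mu\star b\|_1+h^T\mu+\epsilon_y\|\mu\star[1;a]\|_1<0$, and scaling drives this value
to $-\infty$; on $\mathcal P$ the choice $\mu=0$ gives $0$. So if $q>0$ on $\mathcal P$, every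
$x\in\Pi$ has a $\mu$ with value below $q(x)$ (`exists_dualValue_lt`).

Replacing the absolute values by strict upper bounds $v,w$ turns the admissible $(\mu,v,w)$ into an
open set with convex fibres. Over the compact $\Pi$ it has a continuous section, and then a
polynomial one by Stone–Weierstrass (`exists_polynomial_strictDual`). The polynomials
$\psi^\pm=(v\pm\mu\star b)/2$, $\zeta^\pm=(w\pm\mu\star[1;a])/2$ and $-Q$ are then positive on
$\Pi$, so Putinar's theorem puts them in $\Sigma[\Pi]$. They do not depend on $d$, so the degree
bounds hold for all large $d$.

The other direction is weak duality, `neg_Q_le`. Putinar's theorem comes from maximal quadratic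
modules: in the Archimedean case they yield real points. -/

namespace EIV

/-- A quadratic module of a commutative ring. -/
structure IsQuadraticModule {A : Type*} [CommRing A] (M : Set A) : Prop where
  one_mem : 1 ∈ M
  add_mem : ∀ {x y}, x ∈ M → y ∈ M → x + y ∈ M
  sq_mul_mem : ∀ (a : A) {x}, x ∈ M → a * a * x ∈ M

namespace IsQuadraticModule

variable {A : Type*} [CommRing A] {M : Set A}

theorem zero_mem (hM : IsQuadraticModule M) : (0 : A) ∈ M := by
  simpa using hM.sq_mul_mem 0 hM.one_mem

theorem sumSq_mul_mem (hM : IsQuadraticModule M) {s x : A} (hs : IsSumSq s) (hx : x ∈ M) :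
    s * x ∈ M := by
  induction hs with
  | zero => simpa using hM.zero_mem
  | sq_add a _ ih => rw [add_mul]; exact hM.add_mem (hM.sq_mul_mem a hx) ih

theorem sumSq_mem (hM : IsQuadraticModule M) {s : A} (hs : IsSumSq s) : s ∈ M := by
  simpa using hM.sumSq_mul_mem hs hM.one_mem

/-- The set `M - Σ f`, where `Σ` is the set of sums of squares. -/
def adjoinNeg (M : Set A) (f : A) : Set A :=
  {x | ∃ m ∈ M, ∃ s, IsSumSq s ∧ x = m - s * f}

theorem isQuadraticModule_adjoinNeg (hM : IsQuadraticModule M) (f : A) :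
    IsQuadraticModule (adjoinNeg M f) where
  one_mem := ⟨1, hM.one_mem, 0, .zero, by simp⟩
  add_mem := by
    rintro _ _ ⟨m, hm, s, hs, rfl⟩ ⟨n, hn, t, ht, rfl⟩
    exact ⟨m + n, hM.add_mem hm hn, s + t, hs.add ht, by ring⟩
  sq_mul_mem := by
    rintro a _ ⟨m, hm, s, hs, rfl⟩
    exact ⟨a * a * m, hM.sq_mul_mem a hm, a * a * s, (IsSumSq.mul_self a).mul hs, by ring⟩

theorem subset_adjoinNeg (M : Set A) (f : A) : M ⊆ adjoinNeg M f :=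
  fun m hm => ⟨m, hm, 0, .zero, by simp⟩

theorem neg_mem_adjoinNeg (hM : IsQuadraticModule M) (f : A) : -f ∈ adjoinNeg M f :=
  ⟨0, hM.zero_mem, 1, .one, by simp⟩

theorem exists_maximal (hM : IsQuadraticModule M) (h1 : (-1 : A) ∉ M) :
    ∃ Q : Set A, M ⊆ Q ∧ IsQuadraticModule Q ∧ (-1 : A) ∉ Q ∧
      ∀ N : Set A, IsQuadraticModule N → (-1 : A) ∉ N → Q ⊆ N → N ⊆ Q := by
  obtain ⟨Q, hMQ, hQ⟩ := zorn_subset_nonempty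
    {Q : Set A | IsQuadraticModule Q ∧ (-1 : A) ∉ Q} (fun c hc hchain hne => by
      refine ⟨⋃₀ c, ⟨⟨?_, ?_, ?_⟩, ?_⟩, fun s hs => Set.subset_sUnion_of_mem hs⟩
      · obtain ⟨s, hs⟩ := hne
        exact ⟨s, hs, (hc hs).1.one_mem⟩
      · rintro x y ⟨s, hs, hx⟩ ⟨t, ht, hy⟩
        rcases hchain.total hs ht with h | h
        · exact ⟨t, ht, (hc ht).1.add_mem (h hx) hy⟩
        · exact ⟨s, hs, (hc hs).1.add_mem hx (h hy)⟩
      · rintro a x ⟨s, hs, hx⟩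
        exact ⟨s, hs, (hc hs).1.sq_mul_mem a hx⟩
      · rintro ⟨s, hs, hx⟩
        exact (hc hs).2 hx) M ⟨hM, h1⟩
  exact ⟨Q, hMQ, hQ.prop.1, hQ.prop.2, fun N hN hN1 hQN => hQ.le_of_ge ⟨hN, hN1⟩ hQN⟩

variable [Algebra ℝ A]

theorem algebraMap_mul_mem (hM : IsQuadraticModule M) {r : ℝ} (hr : 0 ≤ r) {x : A} (hx : x ∈ M) :
    algebraMap ℝ A r * x ∈ M := by
  have := hM.sq_mul_mem (algebraMap ℝ A (√r)) hx
  rwa [← map_mul, Real.mul_self_sqrt hr] at this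

theorem algebraMap_mem (hM : IsQuadraticModule M) {r : ℝ} (hr : 0 ≤ r) : algebraMap ℝ A r ∈ M := by
  simpa using hM.algebraMap_mul_mem hr hM.one_mem

theorem of_algebraMap_mul_mem (hM : IsQuadraticModule M) {r : ℝ} (hr : 0 < r) {x : A}
    (hx : algebraMap ℝ A r * x ∈ M) : x ∈ M := by
  have := hM.algebraMap_mul_mem (inv_nonneg.2 hr.le) hx
  rwa [← mul_assoc, ← map_mul, inv_mul_cancel₀ hr.ne', map_one, one_mul] at this

theorem algebraMap_sub_mem_mono (hM : IsQuadraticModule M) {r s : ℝ} (hrs : r ≤ s) {a : A}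
    (h : algebraMap ℝ A r - a ∈ M) : algebraMap ℝ A s - a ∈ M := by
  have := hM.add_mem h (hM.algebraMap_mem (A := A) (sub_nonneg.2 hrs))
  rw [map_sub] at this
  convert this using 1
  ring

/-- `k² - a²` lies in a quadratic module that contains `k - a` and `k + a`. -/
theorem sq_sub_sq_mem (hM : IsQuadraticModule M) {k : ℝ} (hk : 0 < k) {a : A}
    (h₁ : algebraMap ℝ A k - a ∈ M) (h₂ : algebraMap ℝ A k + a ∈ M) :
    algebraMap ℝ A (k * k) - a * a ∈ M := by
  -- $2k(k^2-a^2)=(k-a)^2(k+a)+(k+a)^2(k-a)$.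
  refine hM.of_algebraMap_mul_mem (r := 2 * k) (by positivity) ?_
  have := hM.add_mem (hM.sq_mul_mem (algebraMap ℝ A k - a) h₂)
    (hM.sq_mul_mem (algebraMap ℝ A k + a) h₁)
  convert this using 1
  simp only [map_mul, map_ofNat]
  ring

/-- Otherwise maximality gives $-1=q_1+s_1f$ and $-1=q_2-s_2f$ with $q_i\in M$ and $s_i$ sums of
squares. Eliminating $f$ gives $-s_1=s_2+s_1q_2+s_2q_1\in M$. With both $\pm s_1\in M$, the identity
$4s_1f=(f+1)^2s_1-(f-1)^2s_1$ puts $s_1f$ in $M$, hence $-1\in M$. -/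
theorem mem_or_neg_mem (hM : IsQuadraticModule M) (h1 : (-1 : A) ∉ M)
    (hmax : ∀ N : Set A, IsQuadraticModule N → (-1 : A) ∉ N → M ⊆ N → N ⊆ M) (f : A) :
    f ∈ M ∨ -f ∈ M := by
  by_contra! hf
  have key : ∀ g : A, -g ∉ M → (-1 : A) ∈ adjoinNeg M g := fun g hg => by
    by_contra h
    exact hg (hmax _ (hM.isQuadraticModule_adjoinNeg g) h (subset_adjoinNeg M g)
      (hM.neg_mem_adjoinNeg g))
  obtain ⟨q₁, hq₁, s₁, hs₁, e₁⟩ := key (-f) (by simpa using hf.1)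
  obtain ⟨q₂, hq₂, s₂, hs₂, e₂⟩ := key f hf.2
  have hneg : -s₁ ∈ M := by
    have := hM.add_mem (hM.add_mem (hM.sumSq_mem hs₂) (hM.sumSq_mul_mem hs₁ hq₂))
      (hM.sumSq_mul_mem hs₂ hq₁)
    convert this using 1
    linear_combination s₁ * e₂ + s₂ * e₁
  refine h1 ?_
  have h4 : s₁ * f ∈ M := by
    refine hM.of_algebraMap_mul_mem (r := 4) (by norm_num) ?_
    have := hM.add_mem (hM.sq_mul_mem (f + 1) (hM.sumSq_mem hs₁)) (hM.sq_mul_mem (f - 1) hneg)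
    convert this using 1
    simp only [map_ofNat]
    ring
  have := hM.add_mem hq₁ h4
  convert this using 1
  linear_combination e₁

/-- An Archimedean quadratic module that contains `a` or `-a` for all `a`, but not `-1`, is
nonnegative under some homomorphism to the reals. -/
theorem exists_algHom_of_total (hM : IsQuadraticModule M) (h1 : (-1 : A) ∉ M)
    (htot : ∀ f, f ∈ M ∨ -f ∈ M) (harch : ∀ a : A, ∃ r : ℝ, algebraMap ℝ A r - a ∈ M) :
    ∃ α : A →ₐ[ℝ] ℝ, ∀ m ∈ M, 0 ≤ α m := by
  have hconst : ∀ r : ℝ, algebraMap ℝ A r ∈ M → 0 ≤ r := fun r hr => by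
    by_contra! h
    refine h1 (hM.of_algebraMap_mul_mem (neg_pos.2 h) ?_)
    simpa using hr
  -- $u(a)$ is the cut that $a$ defines in $\mathbb R$ for the preorder $x\le y\iff y-x\in M$;
  -- totality fills the lower half.
  have hex : ∀ a : A, ∃ u : ℝ, (∀ r, u < r → algebraMap ℝ A r - a ∈ M) ∧
      ∀ r, r < u → a - algebraMap ℝ A r ∈ M := fun a => by
    have hne : {r : ℝ | algebraMap ℝ A r - a ∈ M}.Nonempty := harch a
    obtain ⟨N, hN⟩ := harch (-a)
    have hbdd : BddBelow {r : ℝ | algebraMap ℝ A r - a ∈ M} := by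
      refine ⟨-N, fun r (hr : algebraMap ℝ A r - a ∈ M) => ?_⟩
      have := hconst (r + N) (by
        rw [map_add]
        convert hM.add_mem hr hN using 1
        ring)
      linarith
    refine ⟨sInf {r : ℝ | algebraMap ℝ A r - a ∈ M}, fun r hr => ?_, fun r hr => ?_⟩
    · obtain ⟨s, hs, hsr⟩ := exists_lt_of_csInf_lt hne hr
      exact hM.algebraMap_sub_mem_mono hsr.le hs
    · rcases htot (algebraMap ℝ A r - a) with h | h
      · exact absurd (csInf_le hbdd h) (not_le.2 hr)
      · simpa using h
  choose u hu₁ hu₂ using hex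
  have hle : ∀ {a : A} {r : ℝ}, algebraMap ℝ A r - a ∈ M → u a ≤ r := fun {a r} h => by
    by_contra! hlt
    obtain ⟨s, hs₁, hs₂⟩ := exists_between hlt
    have := hconst (r - s) (by
      rw [map_sub]
      convert hM.add_mem h (hu₂ a s hs₂) using 1
      ring)
    linarith
  have hge : ∀ {a : A} {r : ℝ}, a - algebraMap ℝ A r ∈ M → r ≤ u a := fun {a r} h => by
    by_contra! hlt
    obtain ⟨s, hs₁, hs₂⟩ := exists_between hlt
    have := hconst (s - r) (by
      rw [map_sub]
      convert hM.add_mem (hu₁ a s hs₁) h using 1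
      ring)
    linarith
  have hmap : ∀ r : ℝ, u (algebraMap ℝ A r) = r := fun r =>
    le_antisymm (hle (by simpa using hM.zero_mem)) (hge (by simpa using hM.zero_mem))
  have hadd : ∀ a b, u (a + b) = u a + u b := fun a b => by
    refine le_antisymm (le_of_forall_pos_le_add fun ε hε => ?_)
      (le_of_forall_pos_le_add fun ε hε => ?_)
    · refine hle ?_
      have := hM.add_mem (hu₁ a (u a + ε / 2) (by linarith)) (hu₁ b (u b + ε / 2) (by linarith))
      convert this using 1
      rw [show u a + u b + ε = (u a + ε / 2) + (u b + ε / 2) by ring, map_add _ (u a + ε / 2)]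
      ring
    · rw [← sub_le_iff_le_add]
      refine hge ?_
      have := hM.add_mem (hu₂ a (u a - ε / 2) (by linarith)) (hu₂ b (u b - ε / 2) (by linarith))
      convert this using 1
      rw [show u a + u b - ε = (u a - ε / 2) + (u b - ε / 2) by ring, map_add _ (u a - ε / 2)]
      ring
  have hnonneg : ∀ m ∈ M, 0 ≤ u m := fun m hm => hge (by simpa using hm)
  let U : A →+ ℝ := AddMonoidHom.mk' u hadd
  have hU : ∀ a, U a = u a := fun _ => rfl
  have hsq : ∀ a, u a = 0 → u (a * a) = 0 := fun a ha => by
    refine le_antisymm (le_of_forall_pos_le_add fun ε hε => ?_)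
      (hnonneg _ (hM.sumSq_mem (.mul_self a)))
    have hε' := Real.sqrt_pos.2 hε
    have := hM.sq_sub_sq_mem hε' (hu₁ a _ (by rwa [ha])) (by
      simpa [add_comm] using hu₂ a (-√ε) (by rw [ha]; linarith))
    rw [Real.mul_self_sqrt hε.le] at this
    simpa using hle this
  -- Since $u(a^2)=0$, positivity of $u((ka+b)^2)$ is affine in $k$: $2k\,u(ab)+u(b^2)\ge0$ for
  -- every integer $k$, which forces $u(ab)=0$.
  have hmul0 : ∀ a b, u a = 0 → u (a * b) = 0 := fun a b ha => by
    have h : ∀ k : ℤ, 0 ≤ 2 * (k * u (a * b)) + u (b * b) := fun k => by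
      have h := hnonneg _ (hM.sumSq_mem (.mul_self (k • a + b)))
      have e : (k • a + b) * (k • a + b) =
          (k * k) • (a * a) + ((2 * k) • (a * b) + b * b) := by
        simp only [zsmul_eq_mul]
        push_cast
        ring
      rw [e, ← hU, map_add, map_add, map_zsmul, map_zsmul, hU, hU, hU, hsq a ha] at h
      simp only [zsmul_eq_mul] at h
      push_cast at h
      linarith
    by_contra hne
    rcases lt_or_gt_of_ne hne with hlt | hgt
    · obtain ⟨n, hn⟩ := exists_nat_gt (u (b * b) / (-u (a * b)))
      rw [div_lt_iff₀ (by linarith)] at hn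
      have h2 := h n
      have h3 := h (2 * n)
      push_cast at h2 h3
      linarith [hnonneg _ (hM.sumSq_mem (.mul_self b))]
    · obtain ⟨n, hn⟩ := exists_nat_gt (u (b * b) / (u (a * b)))
      rw [div_lt_iff₀ hgt] at hn
      have h2 := h (-n)
      push_cast at h2
      linarith [hnonneg _ (hM.sumSq_mem (.mul_self b))]
  have hsub : ∀ a, u (a - algebraMap ℝ A (u a)) = 0 := fun a => by
    rw [← hU, map_sub, hU, hU, hmap, sub_self]
  have hmul : ∀ a b, u (a * b) = u a * u b := fun a b => by
    have e : a * b = (a - algebraMap ℝ A (u a)) * b +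
        ((b - algebraMap ℝ A (u b)) * algebraMap ℝ A (u a) + algebraMap ℝ A (u a * u b)) := by
      rw [map_mul]
      ring
    rw [e, hadd, hadd, hmul0 _ _ (hsub a), hmul0 _ _ (hsub b), hmap]
    ring
  refine ⟨{ toFun := u, map_one' := by simpa using hmap 1, map_mul' := hmul,
            map_zero' := by simpa using hmap 0, map_add' := hadd, commutes' := hmap }, hnonneg⟩

/-- The Positivstellensatz for Archimedean quadratic modules: an element that is positive at all real
points of the module belongs to it. -/
theorem mem_of_pos (hM : IsQuadraticModule M)
    (harch : ∀ a : A, ∃ r : ℝ, algebraMap ℝ A r - a ∈ M) {f : A}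
    (hf : ∀ α : A →ₐ[ℝ] ℝ, (∀ m ∈ M, 0 ≤ α m) → 0 < α f) : f ∈ M := by
  -- Otherwise a maximal module above $M-\Sigma f$ yields a real point of $M$ where $-f\ge0$.
  have hneg : (-1 : A) ∈ adjoinNeg M f := by
    by_contra h
    obtain ⟨Q, hMQ, hQ, hQ1, hmax⟩ := (hM.isQuadraticModule_adjoinNeg f).exists_maximal h
    have hMQ' := (subset_adjoinNeg M f).trans hMQ
    obtain ⟨α, hα⟩ := hQ.exists_algHom_of_total hQ1 (hQ.mem_or_neg_mem hQ1 hmax)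
      fun a => (harch a).imp fun r hr => hMQ' hr
    have h₁ := hα _ (hMQ (hM.neg_mem_adjoinNeg f))
    rw [map_neg] at h₁
    linarith [hf α fun m hm => hα m (hMQ' hm)]
  obtain ⟨m, hm, s, hs, e⟩ := hneg
  obtain ⟨k, hk, hk₁, hk₂⟩ : ∃ k : ℝ, 0 < k ∧ algebraMap ℝ A k - s * s * f ∈ M ∧
      algebraMap ℝ A (2 * k) - s ∈ M := by
    obtain ⟨N₁, h₁⟩ := harch (s * s * f)
    obtain ⟨N₂, h₂⟩ := harch s
    refine ⟨|N₁| + |N₂| + 1, by positivity, hM.algebraMap_sub_mem_mono ?_ h₁,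
      hM.algebraMap_sub_mem_mono ?_ h₂⟩
    · linarith [le_abs_self N₁, abs_nonneg N₂]
    · linarith [le_abs_self N₂, abs_nonneg N₁, abs_nonneg N₂]
  -- With $-1=m-sf$: $k^2(r-\tfrac1k+f)=(k-s)^2(r+f)+2km+(k-s^2f)+rs(2k-s)$. As $k$ does not depend
  -- on $r$, repeating this brings the constant down from $N$ to at most $0$.
  have step : ∀ r : ℝ, 0 ≤ r → algebraMap ℝ A r + f ∈ M → algebraMap ℝ A (r - 1 / k) + f ∈ M := by
    intro r hr h
    refine hM.of_algebraMap_mul_mem (r := k * k) (by positivity) ?_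
    have h₁ := hM.sq_mul_mem (algebraMap ℝ A k - s) h
    have h₂ := hM.algebraMap_mul_mem (r := 2 * k) (by positivity) hm
    have h₃ := hM.algebraMap_mul_mem hr (hM.sumSq_mul_mem hs hk₂)
    have := hM.add_mem (hM.add_mem h₁ h₂) (hM.add_mem hk₁ h₃)
    convert this using 1
    have e' : algebraMap ℝ A (k * k) * algebraMap ℝ A (r - 1 / k) =
        algebraMap ℝ A k * algebraMap ℝ A k * algebraMap ℝ A r - algebraMap ℝ A k := by
      simp only [← map_mul, ← map_sub]
      congr 1
      field_simp
    rw [mul_add, e']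
    simp only [map_mul, map_ofNat]
    linear_combination (2 * algebraMap ℝ A k) * e
  obtain ⟨N, hN⟩ := harch (-f)
  have iter : ∀ n : ℕ, algebraMap ℝ A (N - n * (1 / k)) + f ∈ M ∨ f ∈ M := by
    intro n
    induction n with
    | zero => left; simpa using hN
    | succ n ih =>
      rcases ih with h | h
      · rcases le_total 0 (N - n * (1 / k)) with h0 | h0
        · left
          convert step _ h0 h using 3
          push_cast
          ring
        · right
          have := hM.add_mem h (hM.algebraMap_mem (A := A) (neg_nonneg.2 h0))
          convert this using 1
          rw [map_neg]
          ring
      · exact .inr h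
  obtain ⟨n, hn⟩ := exists_nat_gt (N * k)
  rcases iter n with h | h
  · have h0 : N - n * (1 / k) ≤ 0 := by
      rw [sub_nonpos, mul_one_div, le_div_iff₀ hk]
      exact hn.le
    have := hM.add_mem h (hM.algebraMap_mem (A := A) (neg_nonneg.2 h0))
    convert this using 1
    rw [map_neg]
    ring
  · exact h

end IsQuadraticModule

/-! ### Weighted sums of squares as an Archimedean quadratic module -/

namespace BSA

open MvPolynomial

variable {σ : Type} (K : BSA σ)

theorem isQuadraticModule_WSOS : IsQuadraticModule K.WSOS where
  one_mem := ⟨1, 0, 0, .one, fun _ => .zero, by simp⟩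
  add_mem := by
    rintro _ _ ⟨s₀, s, φ, hs₀, hs, rfl⟩ ⟨t₀, t, χ, ht₀, ht, rfl⟩
    refine ⟨s₀ + t₀, s + t, φ + χ, hs₀.add ht₀, fun k => (hs k).add (ht k), ?_⟩
    simp only [Pi.add_apply, add_mul, Finset.sum_add_distrib]
    ring
  sq_mul_mem := by
    rintro a _ ⟨s₀, s, φ, hs₀, hs, rfl⟩
    refine ⟨a * a * s₀, fun k => a * a * s k, fun k => a * a * φ k, (IsSumSq.mul_self a).mul hs₀,
      fun k => (IsSumSq.mul_self a).mul (hs k), ?_⟩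
    simp only [mul_add, Finset.mul_sum, mul_assoc]

theorem g_mem_WSOS (k : Fin K.numIneq) : K.g k ∈ K.WSOS := by
  classical
  exact ⟨0, Pi.single k 1, 0, .zero, fun j => by
    rcases eq_or_ne j k with rfl | h <;> simp [*], by simp [Pi.single_apply]⟩

theorem mul_h_mem_WSOS (k : Fin K.numEq) (c : MvPolynomial σ ℝ) : c * K.h k ∈ K.WSOS := by
  classical
  exact ⟨0, 0, Pi.single k c, .zero, fun _ => .zero, by simp [Pi.single_apply]⟩

variable {K}

theorem eval_nonneg_of_mem_WSOS {p : MvPolynomial σ ℝ} (hp : p ∈ K.WSOS) {x : σ → ℝ}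
    (hx : x ∈ K.carrier) : 0 ≤ eval x p := by
  obtain ⟨s₀, s, φ, hs₀, hs, rfl⟩ := hp
  have hsq : ∀ {t : MvPolynomial σ ℝ}, IsSumSq t → 0 ≤ eval x t := fun {t} ht => by
    induction ht with
    | zero => simp
    | sq_add a _ ih => simpa using add_nonneg (mul_self_nonneg _) ih
  simp only [map_add, map_sum, map_mul, hx.2, mul_zero, Finset.sum_const_zero, add_zero]
  exact add_nonneg (hsq hs₀) (Finset.sum_nonneg fun k _ => mul_nonneg (hsq (hs k)) (hx.1 k))

theorem mem_WSOS_of_mem_WSOSLe {n : ℕ} {p : MvPolynomial σ ℝ} (hp : p ∈ K.WSOSLe n) :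
    p ∈ K.WSOS := by
  obtain ⟨s₀, s, φ, hs₀, hs, -, -, -, h⟩ := hp
  exact ⟨s₀, s, φ, hs₀, hs, h⟩

theorem eventually_mem_WSOSLe {p : MvPolynomial σ ℝ} (hp : p ∈ K.WSOS) :
    ∀ᶠ n in Filter.atTop, p ∈ K.WSOSLe n := by
  obtain ⟨s₀, s, φ, hs₀, hs, h⟩ := hp
  filter_upwards [Filter.eventually_ge_atTop s₀.totalDegree,
    Filter.eventually_all.2 fun k => Filter.eventually_ge_atTop (s k * K.g k).totalDegree,
    Filter.eventually_all.2 fun k => Filter.eventually_ge_atTop (φ k * K.h k).totalDegree]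
    with n h₁ h₂ h₃
  exact ⟨s₀, s, φ, hs₀, hs, h₁, h₂, h₃, h⟩

variable [Fintype σ]

/-- The elements bounded on both sides modulo $\Sigma[K]$ form a subalgebra. It contains the
variables because $2(R+1\mp X_i)=(R-X_i^2)+(X_i\mp1)^2+(R+1)$, and it is closed under products
because $4pX_i=(p+X_i)^2-(p-X_i)^2$. -/
theorem IsArchimedean.exists_sub_mem (hK : K.IsArchimedean) (a : MvPolynomial σ ℝ) :
    ∃ r : ℝ, algebraMap ℝ _ r - a ∈ K.WSOS := by
  classical
  have hM := K.isQuadraticModule_WSOS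
  suffices h : ∃ r : ℝ, 0 < r ∧ algebraMap ℝ _ r - a ∈ K.WSOS ∧ algebraMap ℝ _ r + a ∈ K.WSOS from
    h.imp fun r hr => hr.2.1
  have hadd : ∀ p q : MvPolynomial σ ℝ,
      (∃ r : ℝ, 0 < r ∧ algebraMap ℝ _ r - p ∈ K.WSOS ∧ algebraMap ℝ _ r + p ∈ K.WSOS) →
      (∃ r : ℝ, 0 < r ∧ algebraMap ℝ _ r - q ∈ K.WSOS ∧ algebraMap ℝ _ r + q ∈ K.WSOS) →
      ∃ r : ℝ, 0 < r ∧ algebraMap ℝ _ r - (p + q) ∈ K.WSOS ∧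
        algebraMap ℝ _ r + (p + q) ∈ K.WSOS := by
    rintro p q ⟨r, hr, h₁, h₂⟩ ⟨s, hs, h₃, h₄⟩
    refine ⟨r + s, by positivity, ?_, ?_⟩
    · convert hM.add_mem h₁ h₃ using 1
      rw [map_add]; ring
    · convert hM.add_mem h₂ h₄ using 1
      rw [map_add]; ring
  induction a using MvPolynomial.induction_on with
  | C c =>
    refine ⟨|c| + 1, by positivity, ?_, ?_⟩
    · have := hM.algebraMap_mem (A := MvPolynomial σ ℝ) (r := |c| + 1 - c)
        (by linarith [le_abs_self c])
      rwa [map_sub] at this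
    · have := hM.algebraMap_mem (A := MvPolynomial σ ℝ) (r := |c| + 1 + c)
        (by linarith [neg_abs_le c])
      rwa [map_add _ (|c| + 1)] at this
  | add p q hp hq => exact hadd p q hp hq
  | mul_X p i hp =>
    have hX : ∃ r : ℝ, 0 < r ∧ algebraMap ℝ (MvPolynomial σ ℝ) r - X i ∈ K.WSOS ∧
        algebraMap ℝ _ r + X i ∈ K.WSOS := by
      obtain ⟨R, hR, h⟩ := hK
      have hi : (C R - X i * X i : MvPolynomial σ ℝ) ∈ K.WSOS := by
        convert hM.add_mem h (hM.sumSq_mem (IsSumSq.sum_sq (Finset.univ.erase i) X)) using 1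
        rw [← Finset.add_sum_erase _ _ (Finset.mem_univ i)]
        ring
      refine ⟨R + 1, by positivity, ?_, ?_⟩
      · refine hM.of_algebraMap_mul_mem (r := 2) two_pos ?_
        convert hM.add_mem (hM.add_mem hi (hM.sumSq_mem (.mul_self (X i - 1))))
          (hM.algebraMap_mem (r := R + 1) (by positivity)) using 1
        simp only [MvPolynomial.algebraMap_eq, map_add, map_one, map_ofNat]
        ring
      · refine hM.of_algebraMap_mul_mem (r := 2) two_pos ?_
        convert hM.add_mem (hM.add_mem hi (hM.sumSq_mem (.mul_self (X i + 1))))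
          (hM.algebraMap_mem (r := R + 1) (by positivity)) using 1
        simp only [MvPolynomial.algebraMap_eq, map_add, map_one, map_ofNat]
        ring
    have hsq : ∀ q : MvPolynomial σ ℝ,
        (∃ r : ℝ, 0 < r ∧ algebraMap ℝ _ r - q ∈ K.WSOS ∧ algebraMap ℝ _ r + q ∈ K.WSOS) →
        ∃ r : ℝ, 0 < r ∧ algebraMap ℝ _ r - q * q ∈ K.WSOS ∧ algebraMap ℝ _ r + q * q ∈ K.WSOS := by
      rintro q ⟨r, hr, h₁, h₂⟩
      exact ⟨r * r, by positivity, hM.sq_sub_sq_mem hr h₁ h₂,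
        hM.add_mem (hM.algebraMap_mem (by positivity)) (hM.sumSq_mem (.mul_self q))⟩
    have hneg : ∀ q : MvPolynomial σ ℝ,
        (∃ r : ℝ, 0 < r ∧ algebraMap ℝ _ r - q ∈ K.WSOS ∧ algebraMap ℝ _ r + q ∈ K.WSOS) →
        ∃ r : ℝ, 0 < r ∧ algebraMap ℝ _ r - (-q) ∈ K.WSOS ∧ algebraMap ℝ _ r + -q ∈ K.WSOS := by
      rintro q ⟨r, hr, h₁, h₂⟩
      exact ⟨r, hr, by simpa using h₂, by simpa [sub_eq_add_neg] using h₁⟩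
    obtain ⟨r, hr, h₁, h₂⟩ := hadd _ _ (hsq _ (hadd _ _ hp hX))
      (hneg _ (hsq _ (hadd _ _ hp (hneg _ hX))))
    refine ⟨r, hr, hM.of_algebraMap_mul_mem (r := 4) (by norm_num) ?_,
      hM.of_algebraMap_mul_mem (r := 4) (by norm_num) ?_⟩
    · convert hM.add_mem h₁ (hM.algebraMap_mul_mem (r := 3) (by norm_num)
        (hM.algebraMap_mem hr.le)) using 1
      simp only [map_ofNat]
      ring
    · convert hM.add_mem h₂ (hM.algebraMap_mul_mem (r := 3) (by norm_num)
        (hM.algebraMap_mem hr.le)) using 1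
      simp only [map_ofNat]
      ring

/-- Putinar's Positivstellensatz. -/
theorem IsArchimedean.mem_WSOS_of_pos (hK : K.IsArchimedean) {f : MvPolynomial σ ℝ}
    (hf : ∀ x ∈ K.carrier, 0 < eval x f) : f ∈ K.WSOS := by
  refine K.isQuadraticModule_WSOS.mem_of_pos hK.exists_sub_mem fun α hα => ?_
  -- A homomorphism to $\mathbb R$ is evaluation at a point, and nonnegativity on $g_k$ and $\pm
  -- h_k$ puts that point in the carrier.
  have hα' : ∀ p, α p = eval (fun i => α (X i)) p := fun p => by
    conv_lhs => rw [MvPolynomial.aeval_unique α]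
    rw [← MvPolynomial.coe_aeval_eq_eval]
    rfl
  rw [hα']
  refine hf _ ⟨fun k => ?_, fun k => le_antisymm ?_ ?_⟩
  · rw [← hα']
    exact hα _ (K.g_mem_WSOS k)
  · have := hα _ (K.mul_h_mem_WSOS k (-1))
    rw [← hα']
    simpa using this
  · have := hα _ (K.mul_h_mem_WSOS k 1)
    rw [← hα']
    simpa using this

theorem IsArchimedean.isCompact_carrier (hK : K.IsArchimedean) : IsCompact K.carrier := by
  obtain ⟨R, hR, h⟩ := hK
  refine Metric.isCompact_of_isClosed_isBounded ?_ ?_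
  · have : K.carrier = (⋂ k, {x | 0 ≤ eval x (K.g k)}) ∩ ⋂ k, {x | eval x (K.h k) = 0} := by
      ext x
      simp [carrier]
    rw [this]
    exact (isClosed_iInter fun k => isClosed_le continuous_const (continuous_eval _)).inter
      (isClosed_iInter fun k => isClosed_eq (continuous_eval _) continuous_const)
  · refine (Metric.isBounded_closedBall (x := (0 : σ → ℝ)) (r := √R)).subset fun x hx => ?_
    have hx' := eval_nonneg_of_mem_WSOS h hx
    simp only [map_sub, eval_C, map_sum, map_pow, eval_X] at hx'
    rw [mem_closedBall_zero_iff, pi_norm_le_iff_of_nonneg (Real.sqrt_nonneg R)]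
    intro i
    refine Real.abs_le_sqrt ?_
    linarith [Finset.single_le_sum (fun j _ => sq_nonneg (x j)) (Finset.mem_univ i)]

end BSA

end EIV

/-! ### Summation by parts for the cross-correlation -/

namespace EIV

theorem map_crossCorr {R S : Type} [CommRing R] [CommRing S] (φ : R →+* S) {T n : ℕ}
    (x : Times 1 T → R) (y : Fin n → R) (j : ℤ) :
    φ (crossCorr x y j) = crossCorr (fun t => φ (x t)) (fun i => φ (y i)) j := by
  have h : ∀ t, φ (extendZero x t) = extendZero (fun t => φ (x t)) t := fun t => by
    unfold extendZero
    split_ifs <;> simp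
  simp [crossCorr, h]

theorem sum_mul_extendZero {R : Type} [CommRing R] {T : ℕ} {r s : ℤ} (k : ℤ)
    (e : Times 1 T → Times r s) (he : ∀ t, (e t).1 = t.1 - k) (f : Times r s → R)
    (μ : Times 1 T → R) :
    ∑ j, f j * extendZero μ (j.1 + k) = ∑ t, μ t * f (e t) := by
  symm
  refine Fintype.sum_of_injective e (fun t t' h => ?_) _ _ (fun j hj => ?_) (fun t => ?_)
  · have h₁ := he t
    have h₂ := he t'
    rw [h] at h₁
    exact Subtype.ext (by linarith)
  · rw [extendZero, dif_neg, mul_zero]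
    intro h
    exact hj ⟨⟨_, h⟩, Subtype.ext (by rw [he]; simp)⟩
  · have h : (e t).1 + k = t.1 := by rw [he]; ring
    rw [h, extendZero, dif_pos t.2, mul_comm]

/-- Cross-correlation is the adjoint of the lagged sum. The position offset `c` fixes the lag: `c =
n` gives lag $i+1$ (inputs), `c = n - 1` gives lag $i$ (outputs, where entry $0$ is the leading
$1$). -/
theorem sum_mul_crossCorr {R : Type} [CommRing R] {T n : ℕ} {r s : ℤ} (c : ℤ)
    (e : Times 1 T → Fin n → Times r s) (he : ∀ t i, (e t i).1 = t.1 - (i.1 + 1 + c - n))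
    (f : Times r s → R) (μ : Times 1 T → R) (y : Fin n → R) :
    ∑ j, f j * crossCorr μ y (j.1 + c) = ∑ t, μ t * ∑ i, y i * f (e t i) := by
  simp only [crossCorr, Finset.mul_sum]
  rw [Finset.sum_comm, Finset.sum_comm (s := (Finset.univ : Finset (Times 1 T)))]
  refine Finset.sum_congr rfl fun i _ => ?_
  have := congrArg (y i * ·)
    (sum_mul_extendZero (i.1 + 1 + c - n) (fun t => e t i) (fun t => he t i) f μ)
  simp only [Finset.mul_sum] at this
  convert this using 2 with j _ t _
  · rw [show (i.1 + 1 : ℤ) + (j.1 + c) - n = j.1 + (i.1 + 1 + c - n) by ring]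
    ring
  · ring

theorem sum_mul_crossCorr_input {R : Type} [CommRing R] {nb T : ℕ} (f : TimesU nb T → R)
    (μ : Times 1 T → R) (b : Fin nb → R) :
    ∑ j, f j * crossCorr μ b (j.1 + nb) = ∑ t, μ t * ∑ i, b i * f (lagU t i) :=
  sum_mul_crossCorr _ lagU (fun t i => by simp [lagU]) f μ b

theorem sum_mul_crossCorr_output {R : Type} [CommRing R] {na T : ℕ} (f : TimesY na T → R)
    (μ : Times 1 T → R) (a : Fin na → R) :
    ∑ j, f j * crossCorr μ (Fin.cons 1 a : Fin (na + 1) → R) (j.1 + na) =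
      ∑ t, μ t * (f (nowY t) + ∑ i, a i * f (lagY t i)) := by
  rw [sum_mul_crossCorr _ (fun t => Fin.cons (nowY t) (lagY t)) (fun t i => ?_) f μ]
  · simp [Fin.sum_univ_succ]
  · refine Fin.cases ?_ (fun i => ?_) i
    · simp [nowY]
      ring
    · simp [lagY]
      ring

/-! ### Approximation by polynomials on compact sets -/

theorem exists_mvPolynomial_near {σ : Type} {S : Set (σ → ℝ)} (hS : IsCompact S) (f : C(S, ℝ))
    {δ : ℝ} (hδ : 0 < δ) :
    ∃ p : MvPolynomial σ ℝ, ∀ x : S, dist (MvPolynomial.eval x.1 p) (f x) < δ := by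
  have := isCompact_iff_compactSpace.1 hS
  let φ : MvPolynomial σ ℝ →ₐ[ℝ] C(S, ℝ) :=
    MvPolynomial.aeval fun i => ⟨fun x => x.1 i, (continuous_apply i).comp continuous_subtype_val⟩
  have hφ : ∀ p x, φ p x = MvPolynomial.eval x.1 p := fun p x => by
    induction p using MvPolynomial.induction_on with
    | C c => simp [φ]
    | add p q hp hq => simp [hp, hq]
    | mul_X p i hp => simp [hp]; simp [φ]
  have hsep : φ.range.SeparatesPoints := fun x y hxy => by
    obtain ⟨i, hi⟩ := Function.ne_iff.1 (Subtype.coe_injective.ne hxy)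
    exact ⟨φ (.X i), ⟨_, ⟨.X i, rfl⟩, rfl⟩, by simpa [hφ] using hi⟩
  obtain ⟨⟨_, p, rfl⟩, hp⟩ :=
    ContinuousMap.exists_mem_subalgebra_near_continuousMap_of_separatesPoints φ.range hsep f δ hδ
  refine ⟨p, fun x => ?_⟩
  rw [← hφ, Real.dist_eq]
  exact (ContinuousMap.norm_coe_le_norm (φ p - f) x).trans_lt hp

/-! ### The robust counterpart -/

namespace Data

variable {na nb T : ℕ}

/-- Multipliers `μ` of the data-consistency equations, together with bounds of the absolute values
of `μ ⋆ b` and of `μ ⋆ [1; a]`. -/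
abbrev Dual (na nb T : ℕ) : Type :=
  (Times 1 T → ℝ) × (TimesU nb T → ℝ) × (TimesY na T → ℝ)

/-- The coefficients `b` at the point `x = (a, b)`. -/
abbrev inputCoeff (x : Var na nb → ℝ) : Fin nb → ℝ := fun i => x (Sum.inr i)

/-- The coefficients `[1; a]` at the point `x = (a, b)`. -/
abbrev outputCoeff (x : Var na nb → ℝ) : Fin (na + 1) → ℝ := Fin.cons 1 fun i => x (Sum.inl i)

/-- The pairs of a point `x = (a, b)` and strictly feasible dual variables certifying `q x > 0`. -/
def strictDual (D : Data na nb T) (q : MvPolynomial (Var na nb) ℝ) :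
    Set ((Var na nb → ℝ) × Dual na nb T) :=
  {z | (∀ s : TimesU nb T, |crossCorr z.2.1 (inputCoeff z.1) (s.1 + nb)| < z.2.2.1 s) ∧
    (∀ s : TimesY na T, |crossCorr z.2.1 (outputCoeff z.1) (s.1 + na)| < z.2.2.2 s) ∧
    D.epsU * ∑ s, z.2.2.1 s + ∑ t, MvPolynomial.eval z.1 (D.h t) * z.2.1 t
      + D.epsY * ∑ s, z.2.2.2 s < MvPolynomial.eval z.1 q}

/-! ### Openness and convexity of the strictly feasible dual set -/

theorem continuous_extendZero {X : Type*} [TopologicalSpace X] {f : X → Times 1 T → ℝ}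
    (hf : Continuous f) (t : ℤ) : Continuous fun x => extendZero (f x) t := by
  unfold extendZero
  split_ifs <;> fun_prop

theorem continuous_crossCorr {X : Type*} [TopologicalSpace X] {n : ℕ} {f : X → Times 1 T → ℝ}
    {g : X → Fin n → ℝ} (hf : Continuous f) (hg : Continuous g) (j : ℤ) :
    Continuous fun x => crossCorr (f x) (g x) j :=
  continuous_finsetSum _ fun i _ => (continuous_extendZero hf _).mul (by fun_prop)

theorem isOpen_strictDual (D : Data na nb T) (q : MvPolynomial (Var na nb) ℝ) :
    IsOpen (D.strictDual q) := by
  have hout : Continuous fun z : (Var na nb → ℝ) × Dual na nb T => outputCoeff z.1 := by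
    refine continuous_pi fun i => ?_
    refine Fin.cases ?_ (fun i => ?_) i
    · simpa using continuous_const
    · simp only [Fin.cons_succ]
      fun_prop
  have heval : ∀ p : MvPolynomial (Var na nb) ℝ,
      Continuous fun z : (Var na nb → ℝ) × Dual na nb T => MvPolynomial.eval z.1 p := fun p =>
    (MvPolynomial.continuous_eval p).comp continuous_fst
  have e : D.strictDual q =
      (⋂ s : TimesU nb T, {z | |crossCorr z.2.1 (inputCoeff z.1) (s.1 + nb)| < z.2.2.1 s}) ∩
      ((⋂ s : TimesY na T, {z | |crossCorr z.2.1 (outputCoeff z.1) (s.1 + na)| < z.2.2.2 s}) ∩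
      {z | D.epsU * ∑ s, z.2.2.1 s + ∑ t, MvPolynomial.eval z.1 (D.h t) * z.2.1 t
        + D.epsY * ∑ s, z.2.2.2 s < MvPolynomial.eval z.1 q}) := by
    ext z
    simp [strictDual]
  rw [e]
  refine (isOpen_iInter_of_finite fun s => isOpen_lt ?_ (by fun_prop)).inter
    ((isOpen_iInter_of_finite fun s => isOpen_lt ?_ (by fun_prop)).inter
      (isOpen_lt ?_ (heval q)))
  · exact (continuous_crossCorr (by fun_prop) (by fun_prop) _).abs
  · exact (continuous_crossCorr (by fun_prop) hout _).abs
  · have : Continuous fun z : (Var na nb → ℝ) × Dual na nb T =>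
        ∑ t, MvPolynomial.eval z.1 (D.h t) * z.2.1 t :=
      continuous_finsetSum _ fun t _ => (heval _).mul (by fun_prop)
    fun_prop

theorem extendZero_combo (c d : ℝ) (μ ν : Times 1 T → ℝ) (t : ℤ) :
    extendZero (c • μ + d • ν) t = c * extendZero μ t + d * extendZero ν t := by
  unfold extendZero
  split_ifs <;> simp

theorem crossCorr_combo {n : ℕ} (c d : ℝ) (μ ν : Times 1 T → ℝ) (y : Fin n → ℝ) (j : ℤ) :
    crossCorr (c • μ + d • ν) y j = c * crossCorr μ y j + d * crossCorr ν y j := by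
  simp only [crossCorr, extendZero_combo, Finset.mul_sum, ← Finset.sum_add_distrib]
  exact Finset.sum_congr rfl fun i _ => by ring

theorem combo_lt_combo {c d a a' b b' : ℝ} (hc : 0 ≤ c) (hd : 0 ≤ d) (hcd : c + d = 1)
    (h : a < b) (h' : a' < b') : c * a + d * a' < c * b + d * b' := by
  rcases hc.eq_or_lt with rfl | hc
  · obtain rfl : d = 1 := by linarith
    simpa using h'
  · exact add_lt_add_of_lt_of_le (mul_lt_mul_of_pos_left h hc) (mul_le_mul_of_nonneg_left h'.le hd)

/-- At fixed $x$ the correlations and the cost are linear in the dual variables, and the absolute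
value is convex. -/
theorem convex_strictDual (D : Data na nb T) (q : MvPolynomial (Var na nb) ℝ)
    (x : Var na nb → ℝ) : Convex ℝ {p | (x, p) ∈ D.strictDual q} := by
  rintro p ⟨h₁, h₂, h₃⟩ p' ⟨h₁', h₂', h₃'⟩ c d hc hd hcd
  have habs : ∀ u v : ℝ, |c * u + d * v| ≤ c * |u| + d * |v| := fun u v =>
    (abs_add_le _ _).trans_eq (by rw [abs_mul, abs_mul, abs_of_nonneg hc, abs_of_nonneg hd])
  refine ⟨fun s => ?_, fun s => ?_, ?_⟩
  · have := combo_lt_combo hc hd hcd (h₁ s) (h₁' s)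
    simp only [Prod.fst_add, Prod.smul_fst, Prod.snd_add, Prod.smul_snd, crossCorr_combo,
      Pi.add_apply, Pi.smul_apply, smul_eq_mul]
    exact (habs _ _).trans_lt this
  · have := combo_lt_combo hc hd hcd (h₂ s) (h₂' s)
    simp only [Prod.fst_add, Prod.smul_fst, Prod.snd_add, Prod.smul_snd, crossCorr_combo,
      Pi.add_apply, Pi.smul_apply, smul_eq_mul]
    exact (habs _ _).trans_lt this
  · have := combo_lt_combo hc hd hcd h₃ h₃'
    rw [← add_mul, hcd, one_mul] at this
    refine lt_of_eq_of_lt ?_ this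
    simp only [Prod.fst_add, Prod.smul_fst, Prod.snd_add, Prod.smul_snd,
      Pi.add_apply, Pi.smul_apply, smul_eq_mul, mul_add, Finset.sum_add_distrib,
      Finset.mul_sum, mul_left_comm _ c, mul_left_comm _ d]
    ring

/-! ### Linear duality at a fixed parameter point -/

/-- The optimal value of the inner maximization over the noise, as a function of the multipliers. -/
noncomputable def dualValue (D : Data na nb T) (x : Var na nb → ℝ) (μ : Times 1 T → ℝ) : ℝ :=
  D.epsU * ∑ s : TimesU nb T, |crossCorr μ (inputCoeff x) (s.1 + nb)|
    + ∑ t, MvPolynomial.eval x (D.h t) * μ t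
    + D.epsY * ∑ s : TimesY na T, |crossCorr μ (outputCoeff x) (s.1 + na)|

theorem dualValue_smul (D : Data na nb T) (x : Var na nb → ℝ) (μ : Times 1 T → ℝ) {c : ℝ}
    (hc : 0 ≤ c) : D.dualValue x (c • μ) = c * D.dualValue x μ := by
  have h : ∀ {n : ℕ} (y : Fin n → ℝ) j, crossCorr (c • μ) y j = c * crossCorr μ y j :=
    fun y j => by simpa using crossCorr_combo c 0 μ μ y j
  simp only [dualValue, h, abs_mul, abs_of_nonneg hc, Pi.smul_apply, smul_eq_mul,
    ← Finset.mul_sum, mul_left_comm _ c]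
  ring

/-- The effect of the noise `(Δu, Δy)` on the data-consistency equations at `x = (a, b)`. -/
def noise (x : Var na nb → ℝ) :
    ((TimesU nb T → ℝ) × (TimesY na T → ℝ)) →ₗ[ℝ] (Times 1 T → ℝ) where
  toFun z t := z.2 (nowY t) + ∑ i, x (Sum.inl i) * z.2 (lagY t i)
    - ∑ i, x (Sum.inr i) * z.1 (lagU t i)
  map_add' z z' := by
    ext t
    simp only [Prod.fst_add, Prod.snd_add, Pi.add_apply, mul_add, Finset.sum_add_distrib]
    ring
  map_smul' c z := by
    ext t
    simp only [Prod.smul_fst, Prod.smul_snd, Pi.smul_apply, smul_eq_mul, RingHom.id_apply,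
      mul_left_comm _ c, ← Finset.mul_sum]
    ring

theorem sum_mul_noise (x : Var na nb → ℝ) (z : (TimesU nb T → ℝ) × (TimesY na T → ℝ))
    (μ : Times 1 T → ℝ) :
    ∑ t, μ t * noise x z t =
      ∑ s : TimesY na T, z.2 s * crossCorr μ (outputCoeff x) (s.1 + na)
        - ∑ s : TimesU nb T, z.1 s * crossCorr μ (inputCoeff x) (s.1 + nb) := by
  rw [sum_mul_crossCorr_output, sum_mul_crossCorr_input, ← Finset.sum_sub_distrib]
  exact Finset.sum_congr rfl fun t _ => mul_sub _ _ _

theorem mem_Pbar_iff (D : Data na nb T) (x : Var na nb → ℝ)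
    (z : (TimesU nb T → ℝ) × (TimesY na T → ℝ)) :
    (x, z) ∈ D.Pbar ↔ ‖z.1‖ ≤ D.epsU ∧ ‖z.2‖ ≤ D.epsY ∧
      noise x z = fun t => MvPolynomial.eval x (D.h t) := by
  refine and_congr_right fun _ => and_congr_right fun _ => ?_
  rw [funext_iff]
  refine forall_congr' fun t => ?_
  simp only [noise, LinearMap.coe_mk, AddHom.coe_mk]
  constructor <;> intro h <;> linarith

/-- The vector $h(x)$ lies outside the compact convex image of the noise box. A separating
functional is the desired $\mu$: its minimum over that image is minus the weighted $\ell^1$ norms in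
`dualValue`. -/
theorem exists_dualValue_neg (D : Data na nb T) (hepsU : 0 ≤ D.epsU) (hepsY : 0 ≤ D.epsY)
    {x : Var na nb → ℝ} (hx : x ∉ D.P) : ∃ μ, D.dualValue x μ < 0 := by
  let B : Set ((TimesU nb T → ℝ) × (TimesY na T → ℝ)) :=
    Metric.closedBall 0 D.epsU ×ˢ Metric.closedBall 0 D.epsY
  have hB : IsCompact B := (isCompact_closedBall _ _).prod (isCompact_closedBall _ _)
  have hBc : Convex ℝ B := (convex_closedBall _ _).prod (convex_closedBall _ _)
  have hcont : Continuous (noise (T := T) x) := LinearMap.continuous_of_finiteDimensional _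
  have hnot : (fun t => MvPolynomial.eval x (D.h t)) ∉ noise x '' B := by
    rintro ⟨z, ⟨hz₁, hz₂⟩, hz⟩
    rw [mem_closedBall_zero_iff] at hz₁ hz₂
    exact hx ⟨(x, z), (D.mem_Pbar_iff x z).2 ⟨hz₁, hz₂, hz⟩, rfl⟩
  obtain ⟨f, u, hu, hf⟩ := geometric_hahn_banach_point_closed (hBc.linear_image (noise x))
    (hB.image hcont).isClosed hnot
  let μ : Times 1 T → ℝ := fun t => f (Pi.single t 1)
  have hμ : ∀ v, f v = ∑ t, μ t * v t := fun v => by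
    have := LinearMap.pi_apply_eq_sum_univ (f : (Times 1 T → ℝ) →ₗ[ℝ] ℝ) v
    simp only [smul_eq_mul, ContinuousLinearMap.coe_coe] at this
    rw [this]
    refine Finset.sum_congr rfl fun t _ => ?_
    rw [mul_comm]
    congr 2
    ext j
    simp [Pi.single_apply, eq_comm]
  let sg : ℝ → ℝ := fun r => SignType.sign r
  have hsg : ∀ r, |sg r| ≤ 1 := fun r => by
    rcases lt_trichotomy r 0 with h | rfl | h <;> simp [sg, *]
  refine ⟨μ, ?_⟩
  -- The minimizing noise is a sign pattern; the signs are opposite for $\Delta u$ and $\Delta y$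
  -- because they enter `noise` with opposite signs.
  have hb := hf _ ⟨(fun s => D.epsU * sg (crossCorr μ (inputCoeff x) (s.1 + nb)),
    fun s => -(D.epsY * sg (crossCorr μ (outputCoeff x) (s.1 + na)))), ⟨?_, ?_⟩, rfl⟩
  · rw [hμ, sum_mul_noise] at hb
    simp only [neg_mul, mul_assoc, sg, sign_mul_self, Finset.sum_neg_distrib,
      ← Finset.mul_sum] at hb
    rw [hμ] at hu
    simp only [dualValue, mul_comm (MvPolynomial.eval x _)]
    linarith
  · rw [mem_closedBall_zero_iff, pi_norm_le_iff_of_nonneg hepsU]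
    intro s
    rw [Real.norm_eq_abs, abs_mul, abs_of_nonneg hepsU]
    exact mul_le_of_le_one_right hepsU (hsg _)
  · rw [mem_closedBall_zero_iff, pi_norm_le_iff_of_nonneg hepsY]
    intro s
    rw [norm_neg, Real.norm_eq_abs, abs_mul, abs_of_nonneg hepsY]
    exact mul_le_of_le_one_right hepsY (hsg _)

theorem exists_dualValue_lt (D : Data na nb T) (hepsU : 0 ≤ D.epsU) (hepsY : 0 ≤ D.epsY)
    {x : Var na nb → ℝ} {r : ℝ} (hx : x ∈ D.P → 0 < r) : ∃ μ, D.dualValue x μ < r := by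
  by_cases h : x ∈ D.P
  · refine ⟨0, ?_⟩
    have := D.dualValue_smul x 0 le_rfl
    rw [zero_mul, smul_zero] at this
    rw [this]
    exact hx h
  · obtain ⟨μ, hμ⟩ := D.exists_dualValue_neg hepsU hepsY h
    -- By positive homogeneity this scaling makes the value exactly $-(|r|+1)$, which is below $r$.
    refine ⟨((|r| + 1) / -D.dualValue x μ) • μ, ?_⟩
    have : 0 < -D.dualValue x μ := by linarith
    rw [dualValue_smul _ _ _ (by positivity), div_neg, neg_mul, div_mul_cancel₀ _ hμ.ne]
    linarith [neg_abs_le r]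

theorem exists_strictDual (D : Data na nb T) (hepsU : 0 ≤ D.epsU) (hepsY : 0 ≤ D.epsY)
    {q : MvPolynomial (Var na nb) ℝ} {x : Var na nb → ℝ}
    (hx : x ∈ D.P → 0 < MvPolynomial.eval x q) : ∃ p, (x, p) ∈ D.strictDual q := by
  obtain ⟨μ, hμ⟩ := D.exists_dualValue_lt hepsU hepsY hx
  set c := D.epsU * Fintype.card (TimesU nb T) + D.epsY * Fintype.card (TimesY na T)
  have hc : 0 ≤ c := by positivity
  -- Raising every bound by $\delta$ makes it strict and costs $c\delta$, which must fit in the gap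
  -- below $q(x)$.
  obtain ⟨δ, hδ, hδ'⟩ : ∃ δ > 0, c * δ < MvPolynomial.eval x q - D.dualValue x μ := by
    refine ⟨(MvPolynomial.eval x q - D.dualValue x μ) / (c + 1),
      div_pos (by linarith) (by positivity), ?_⟩
    rw [mul_div_assoc', div_lt_iff₀ (by positivity)]
    linarith
  refine ⟨(μ, fun s => |crossCorr μ (inputCoeff x) (s.1 + nb)| + δ,
    fun s => |crossCorr μ (outputCoeff x) (s.1 + na)| + δ), fun s => ?_, fun s => ?_, ?_⟩
  · simpa using hδ
  · simpa using hδ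
  · simp only [Finset.sum_add_distrib, Finset.sum_const, Finset.card_univ, nsmul_eq_mul]
    simp only [dualValue, c] at hδ'
    linarith

/-- Strictly feasible dual variables can be chosen to depend polynomially on the parameters. -/
theorem exists_polynomial_strictDual (D : Data na nb T) {q : MvPolynomial (Var na nb) ℝ}
    {S : Set (Var na nb → ℝ)} (hS : IsCompact S) (h : ∀ x ∈ S, ∃ p, (x, p) ∈ D.strictDual q) :
    ∃ (μ : Times 1 T → MvPolynomial (Var na nb) ℝ) (v : TimesU nb T → MvPolynomial (Var na nb) ℝ)
      (w : TimesY na T → MvPolynomial (Var na nb) ℝ), ∀ x ∈ S,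
      (x, (fun t => MvPolynomial.eval x (μ t)), (fun s => MvPolynomial.eval x (v s)),
        fun s => MvPolynomial.eval x (w s)) ∈ D.strictDual q := by
  have := isCompact_iff_compactSpace.1 hS
  -- By openness a dual point for $x$ also serves nearby parameters; a partition of unity glues
  -- these constants, since the fibres are convex.
  obtain ⟨g, hg⟩ := exists_continuous_forall_mem_convex_of_local_const
    (t := fun x : S => {p | (x.1, p) ∈ D.strictDual q}) (fun x => D.convex_strictDual q x)
    fun x => by
      obtain ⟨p, hp⟩ := h x x.2
      refine ⟨p, ?_⟩
      exact ((D.isOpen_strictDual q).preimage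
        (by fun_prop : Continuous fun y : S => (y.1, p))).mem_nhds hp
  have hcomp : IsCompact (Set.range fun x : S => (x.1, g x)) := isCompact_range (by fun_prop)
  -- The graph of $g$ is compact, so a whole $\delta$-neighbourhood of it is admissible. The metric
  -- is the sup metric, so approximating each coordinate within $\delta$ suffices.
  obtain ⟨δ, hδ, hsub⟩ := hcomp.exists_thickening_subset_open (D.isOpen_strictDual q)
    (Set.range_subset_iff.2 hg)
  choose μ hμ using fun t => exists_mvPolynomial_near hS
    ⟨fun x => (g x).1 t, by fun_prop⟩ hδ
  choose v hv using fun s => exists_mvPolynomial_near hS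
    ⟨fun x => (g x).2.1 s, by fun_prop⟩ hδ
  choose w hw using fun s => exists_mvPolynomial_near hS
    ⟨fun x => (g x).2.2 s, by fun_prop⟩ hδ
  refine ⟨μ, v, w, fun x hx => hsub ?_⟩
  rw [Metric.mem_thickening_iff]
  refine ⟨_, ⟨⟨x, hx⟩, rfl⟩, ?_⟩
  simp only [Prod.dist_eq, dist_self, max_lt_iff]
  exact ⟨hδ, (dist_pi_lt_iff hδ).2 fun t => hμ t ⟨x, hx⟩,
    (dist_pi_lt_iff hδ).2 fun s => hv s ⟨x, hx⟩, (dist_pi_lt_iff hδ).2 fun s => hw s ⟨x, hx⟩⟩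

theorem eval_crossCorr_input (x : Var na nb → ℝ) (μ : Times 1 T → MvPolynomial (Var na nb) ℝ)
    (j : ℤ) :
    MvPolynomial.eval x (crossCorr μ (fun i : Fin nb => MvPolynomial.X (Sum.inr i)) j) =
      crossCorr (fun t => MvPolynomial.eval x (μ t)) (inputCoeff x) j := by
  rw [map_crossCorr]
  simp

theorem eval_crossCorr_output (x : Var na nb → ℝ) (μ : Times 1 T → MvPolynomial (Var na nb) ℝ)
    (j : ℤ) :
    MvPolynomial.eval x (crossCorr μ
      (Fin.cons 1 (fun i : Fin na => MvPolynomial.X (Sum.inl i)) :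
        Fin (na + 1) → MvPolynomial (Var na nb) ℝ) j) =
      crossCorr (fun t => MvPolynomial.eval x (μ t)) (outputCoeff x) j := by
  rw [map_crossCorr]
  congr 1
  ext i
  refine Fin.cases ?_ (fun i => ?_) i <;> simp

end Data

/-! ### The Alternatives Psatz -/

namespace Multipliers

variable {na nb T : ℕ} {D : Data na nb T} {K : BSA (Var na nb)} {q : MvPolynomial (Var na nb) ℝ}

theorem eval_Q (m : Multipliers na nb T) (x : Var na nb → ℝ) :
    MvPolynomial.eval x (m.Q D q) = -MvPolynomial.eval x q
      + D.epsU * ∑ s, (MvPolynomial.eval x (m.psiP s) + MvPolynomial.eval x (m.psiM s))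
      + ∑ t, MvPolynomial.eval x (D.h t) * MvPolynomial.eval x (m.mu t)
      + D.epsY * ∑ s, (MvPolynomial.eval x (m.zetaP s) + MvPolynomial.eval x (m.zetaM s)) := by
  simp [Q]

theorem IsAlternPsatz.neg_Q_nonneg {m : Multipliers na nb T} {d : ℕ}
    (hm : m.IsAlternPsatz D K d q) {x : Var na nb → ℝ} (hx : x ∈ K.carrier) :
    0 ≤ -(MvPolynomial.eval x (m.Q D q)) := by
  simpa using BSA.eval_nonneg_of_mem_WSOS (BSA.mem_WSOS_of_mem_WSOSLe hm.neg_Q_mem) hx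

/-- Weak duality: for a noise $(\Delta u,\Delta y)$ consistent with $x$, $\sum
h_t\mu_t=\langle\Delta y,\zeta^+-\zeta^-\rangle-\langle\Delta u,\psi^+-\psi^-\rangle$. The noise
bounds and the nonnegative multipliers make this at least
$-\epsilon_y\sum(\zeta^++\zeta^-)-\epsilon_u\sum(\psi^++\psi^-)$. -/
theorem IsAlternPsatz.neg_Q_le {m : Multipliers na nb T} {d : ℕ}
    (hm : m.IsAlternPsatz D K d q) {x : Var na nb → ℝ} (hxP : x ∈ D.P) (hx : x ∈ K.carrier) :
    -(MvPolynomial.eval x (m.Q D q)) ≤ MvPolynomial.eval x q := by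
  obtain ⟨⟨x, z⟩, hz, rfl⟩ := hxP
  obtain ⟨hu, hy, hh⟩ := (D.mem_Pbar_iff x z).1 hz
  have hpos : ∀ {p}, p ∈ K.WSOSLe (2 * d) → 0 ≤ MvPolynomial.eval x p := fun hp =>
    BSA.eval_nonneg_of_mem_WSOS (BSA.mem_WSOS_of_mem_WSOSLe hp) hx
  have hbound : ∀ {e r p₁ p₂ : ℝ}, |r| ≤ e → 0 ≤ p₁ → 0 ≤ p₂ → |r * (p₁ - p₂)| ≤ e * (p₁ + p₂) :=
    fun {e r p₁ p₂} hr h₁ h₂ => by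
      rw [abs_mul]
      refine mul_le_mul hr ?_ (abs_nonneg _) ((abs_nonneg r).trans hr)
      rw [abs_le]
      constructor <;> linarith
  have hU : ∑ s, z.1 s * crossCorr (fun t => MvPolynomial.eval x (m.mu t)) (Data.inputCoeff x)
      (s.1 + nb) ≤
      D.epsU * ∑ s, (MvPolynomial.eval x (m.psiP s) + MvPolynomial.eval x (m.psiM s)) := by
    rw [Finset.mul_sum]
    refine Finset.sum_le_sum fun s _ => ?_
    rw [← Data.eval_crossCorr_input, ← hm.psi_eq, map_sub]
    exact (abs_le.1 (hbound ((norm_le_pi_norm z.1 s).trans hu) (hpos (hm.psiP_mem s))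
      (hpos (hm.psiM_mem s)))).2
  have hY : -(D.epsY * ∑ s, (MvPolynomial.eval x (m.zetaP s) + MvPolynomial.eval x (m.zetaM s))) ≤
      ∑ s, z.2 s * crossCorr (fun t => MvPolynomial.eval x (m.mu t)) (Data.outputCoeff x)
        (s.1 + na) := by
    rw [Finset.mul_sum, ← Finset.sum_neg_distrib]
    refine Finset.sum_le_sum fun s _ => ?_
    rw [← Data.eval_crossCorr_output, ← hm.zeta_eq, map_sub]
    exact (abs_le.1 (hbound ((norm_le_pi_norm z.2 s).trans hy) (hpos (hm.zetaP_mem s))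
      (hpos (hm.zetaM_mem s)))).1
  have hsum := Data.sum_mul_noise x z fun t => MvPolynomial.eval x (m.mu t)
  rw [hh] at hsum
  simp only [mul_comm (MvPolynomial.eval x (m.mu _))] at hsum
  rw [eval_Q]
  linarith

/-- The multipliers with given `μ`, `ψ⁺ + ψ⁻ = v` and `ζ⁺ + ζ⁻ = w`. -/
noncomputable def ofBounds (μ : Times 1 T → MvPolynomial (Var na nb) ℝ)
    (v : TimesU nb T → MvPolynomial (Var na nb) ℝ) (w : TimesY na T → MvPolynomial (Var na nb) ℝ) :
    Multipliers na nb T where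
  psiP s := MvPolynomial.C (1 / 2) *
    (v s + crossCorr μ (fun i : Fin nb => MvPolynomial.X (Sum.inr i)) (s.1 + nb))
  psiM s := MvPolynomial.C (1 / 2) *
    (v s - crossCorr μ (fun i : Fin nb => MvPolynomial.X (Sum.inr i)) (s.1 + nb))
  zetaP s := MvPolynomial.C (1 / 2) *
    (w s + crossCorr μ (Fin.cons 1 (fun i : Fin na => MvPolynomial.X (Sum.inl i)) :
        Fin (na + 1) → MvPolynomial (Var na nb) ℝ) (s.1 + na))
  zetaM s := MvPolynomial.C (1 / 2) *
    (w s - crossCorr μ (Fin.cons 1 (fun i : Fin na => MvPolynomial.X (Sum.inl i)) :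
        Fin (na + 1) → MvPolynomial (Var na nb) ℝ) (s.1 + na))
  mu := μ

theorem half_mul_add_sub_half_mul_sub {σ : Type} (p r : MvPolynomial σ ℝ) :
    MvPolynomial.C (1 / 2) * (p + r) - MvPolynomial.C (1 / 2) * (p - r) = r := by
  have h : (MvPolynomial.C (1 / 2) : MvPolynomial σ ℝ) * 2 = 1 := by
    rw [← map_ofNat MvPolynomial.C, ← map_mul]
    norm_num
  linear_combination r * h

theorem exists_isAlternPsatz (hK : K.IsArchimedean) (hepsU : 0 ≤ D.epsU) (hepsY : 0 ≤ D.epsY)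
    (hq : ∀ x ∈ D.P, 0 < MvPolynomial.eval x q) :
    ∃ m : Multipliers na nb T, (∀ᶠ d in Filter.atTop, m.IsAlternPsatz D K d q) ∧
      ∀ x ∈ K.carrier, 0 < -(MvPolynomial.eval x (m.Q D q)) := by
  obtain ⟨μ, v, w, h⟩ := D.exists_polynomial_strictDual (q := q) hK.isCompact_carrier
    fun x _ => D.exists_strictDual hepsU hepsY (hq x)
  have hQ : ∀ x ∈ K.carrier, 0 < -(MvPolynomial.eval x ((ofBounds μ v w).Q D q)) := by
    intro x hx
    have := (h x hx).2.2
    have half : ∀ a b : ℝ, 1 / 2 * (a + b) + 1 / 2 * (a - b) = a := fun a b => by ring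
    rw [eval_Q]
    simp only [ofBounds, map_mul, map_add, map_sub, MvPolynomial.eval_C, half]
    linarith
  refine ⟨ofBounds μ v w, ?_, hQ⟩
  have h₁ : ∀ s, (ofBounds μ v w).psiP s ∈ K.WSOS := fun s => hK.mem_WSOS_of_pos fun x hx => by
    have := (abs_lt.1 ((h x hx).1 s)).1
    simp only [ofBounds, map_mul, map_add, MvPolynomial.eval_C, Data.eval_crossCorr_input]
    linarith
  have h₂ : ∀ s, (ofBounds μ v w).psiM s ∈ K.WSOS := fun s => hK.mem_WSOS_of_pos fun x hx => by
    have := (abs_lt.1 ((h x hx).1 s)).2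
    simp only [ofBounds, map_mul, map_sub, MvPolynomial.eval_C, Data.eval_crossCorr_input]
    linarith
  have h₃ : ∀ s, (ofBounds μ v w).zetaP s ∈ K.WSOS := fun s => hK.mem_WSOS_of_pos fun x hx => by
    have := (abs_lt.1 ((h x hx).2.1 s)).1
    simp only [ofBounds, map_mul, map_add, MvPolynomial.eval_C, Data.eval_crossCorr_output]
    linarith
  have h₄ : ∀ s, (ofBounds μ v w).zetaM s ∈ K.WSOS := fun s => hK.mem_WSOS_of_pos fun x hx => by
    have := (abs_lt.1 ((h x hx).2.1 s)).2
    simp only [ofBounds, map_mul, map_sub, MvPolynomial.eval_C, Data.eval_crossCorr_output]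
    linarith
  have h₅ : -((ofBounds μ v w).Q D q) ∈ K.WSOS := hK.mem_WSOS_of_pos fun x hx => by
    simpa using hQ x hx
  have htwo : Filter.Tendsto (fun d : ℕ => 2 * d) Filter.atTop Filter.atTop :=
    Filter.tendsto_atTop_mono (fun d => Nat.le_mul_of_pos_left d two_pos) Filter.tendsto_id
  filter_upwards [
    Filter.eventually_all.2 fun s => htwo.eventually (BSA.eventually_mem_WSOSLe (h₁ s)),
    Filter.eventually_all.2 fun s => htwo.eventually (BSA.eventually_mem_WSOSLe (h₂ s)),
    Filter.eventually_all.2 fun s => htwo.eventually (BSA.eventually_mem_WSOSLe (h₃ s)),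
    Filter.eventually_all.2 fun s => htwo.eventually (BSA.eventually_mem_WSOSLe (h₄ s)),
    htwo.eventually (BSA.eventually_mem_WSOSLe h₅),
    -- The $+1$ encodes the bound $2d-1$ on the degree of $\mu_t$.
    Filter.eventually_all.2 fun t =>
      htwo.eventually (Filter.eventually_ge_atTop ((μ t).totalDegree + 1))]
    with d g₁ g₂ g₃ g₄ g₅ g₆
  exact ⟨g₁, g₂, g₃, g₄,
    fun t e he => (Nat.succ_le_succ (MvPolynomial.le_totalDegree he)).trans (g₆ t), g₅,
    fun s => half_mul_add_sub_half_mul_sub _ _, fun s => half_mul_add_sub_half_mul_sub _ _⟩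

end Multipliers

end EIV

theorem mainTheorem3 (na nb T : ℕ) (D : EIV.Data na nb T)
    (hepsU : 0 ≤ D.epsU) (hepsY : 0 ≤ D.epsY)
    (hA1 : IsCompact D.Pbar)
    (K : EIV.BSA (EIV.Var na nb)) (hA2 : K.IsArchimedean) (hPK : D.P ⊆ K.carrier)
    (q : MvPolynomial (EIV.Var na nb) ℝ) :
    (∀ (d : ℕ) (m : EIV.Multipliers na nb T), m.IsAlternPsatz D K d q →
      ∀ x ∈ D.P, 0 ≤ -(MvPolynomial.eval x (m.Q D q)) ∧
        -(MvPolynomial.eval x (m.Q D q)) ≤ MvPolynomial.eval x q) ∧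
    ((∀ x ∈ D.P, 0 < MvPolynomial.eval x q) ↔
      ∃ d₀ : ℕ, ∀ d : ℕ, d₀ ≤ d → ∃ m : EIV.Multipliers na nb T,
        m.IsAlternPsatz D K d q ∧ ∀ x ∈ D.P, 0 < -(MvPolynomial.eval x (m.Q D q))) := by
  refine ⟨fun d m hm x hx => ⟨hm.neg_Q_nonneg (hPK hx), hm.neg_Q_le hx (hPK hx)⟩, fun hq => ?_, ?_⟩
  · obtain ⟨m, hm, hQ⟩ := EIV.Multipliers.exists_isAlternPsatz hA2 hepsU hepsY hq
    obtain ⟨d₀, hd₀⟩ := Filter.eventually_atTop.1 hm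
    exact ⟨d₀, fun d hd => ⟨m, hd₀ d hd, fun x hx => hQ x (hPK hx)⟩⟩
  · rintro ⟨d₀, h⟩ x hx
    obtain ⟨m, hm, hQ⟩ := h d₀ le_rfl
    exact (hQ x hx).trans_le (hm.neg_Q_le hx (hPK hx))
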